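/- For every integer $n\ge 3$ let $m(n)$ denote the minimum of the algebraic connectivity $a(G)$ over all connected cubic (that is, 3-regular) bipartite simple graphs $G$ on $2n$ vertices, where $a(G)$ is the second smallest eigenvalue, counted with multiplicity, of the Laplacian matrix $L(G)=D(G)-A(G)$ (such graphs exist for every $n\ge 3$, so the minimum is attained). Then $$m(n)=(1+o(1))\,\frac{\pi^{2}}{n^{2}}\qquad (n\to\infty).$$ -/

import Mathlib

open Filter Topology

/-- The algebraic connectivity `a(G)` of a finite graph with at least two vertices: the second
smallest eigenvalue, counted with multiplicity, of the Laplacian matrix `D(G) - A(G)`.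
`Matrix.IsHermitian.eigenvalues₀` lists the eigenvalues with multiplicity in non-increasing order,
with indices `0, …, |V| - 1`, so that the second smallest one has index `|V| - 2`.
(For graphs with fewer than two vertices the value is set to `0`.) -/
noncomputable def algebraicConnectivity {V : Type*} [Fintype V] [DecidableEq V]
    (G : SimpleGraph V) [DecidableRel G.Adj] : ℝ :=
  if h : 2 ≤ Fintype.card V then
    (G.isHermitian_lapMatrix ℝ).eigenvalues₀
      ⟨Fintype.card V - 2, Nat.sub_lt (by omega) (by omega)⟩
  else 0

open scoped Classical in
/-- The set of all values of the algebraic connectivity on the connected cubic (3-regular)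
bipartite graphs on `2 * n` vertices (up to isomorphism, the vertex set is `Fin (2 * n)`). -/
def cubicBipartiteConnectivities (n : ℕ) : Set ℝ :=
  {a | ∃ G : SimpleGraph (Fin (2 * n)),
    G.Connected ∧ G.IsRegularOfDegree 3 ∧ G.IsBipartite ∧ algebraicConnectivity G = a}

/-! Both bounds compare the graph with the path on `n` vertices, whose spectral gap is 2 - 2cos(π/n)
~ π²/n². Lower bound: list the 2n vertices by increasing value of a mean-zero function whose
Rayleigh quotient is at most a(G), and expand each edge's squared increment in consecutive gaps,
keeping only squares and products of neighbouring gaps. Signed counting over the bipartition shows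
that at least 3 edges cross after an odd number of vertices; parity and connectedness give at least
2 after an even number, and hence at least one edge passes over each interior vertex. With these
weights the energy dominates twice the path energy of the midpoints of consecutive pairs, plus the
squared differences within pairs (`IsCubicBipartiteMatrix.path_form_le_energy`). The path gap, being
at most 2, then bounds the whole Rayleigh quotient from below. Upper bound: a thickened path, each
side of the bipartition a copy of 0, …, n - 1 with i joined to j when |i - j| ≤ 1, repaired at the
ends to be cubic. Testing with the path eigenvector cos(π(k + 1/2)/n) costs only a relative error
16/n. -/

/-! ### Rayleigh quotients for the second smallest Laplacian eigenvalue -/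

open Matrix in
theorem Matrix.IsHermitian.dotProduct_mulVec_eq_sum {V : Type*} [Fintype V] [DecidableEq V]
    {A : Matrix V V ℝ} (hA : A.IsHermitian) (x : V → ℝ) :
    x ⬝ᵥ A *ᵥ x = ∑ i, hA.eigenvalues i * (⇑(hA.eigenvectorBasis i) ⬝ᵥ x) ^ 2 := by
  have hAt : Aᵀ = A := by simpa [Matrix.IsHermitian] using hA
  have h := hA.eigenvectorBasis.sum_inner_mul_inner (WithLp.toLp 2 x) (WithLp.toLp 2 (A *ᵥ x))
  simp only [EuclideanSpace.inner_eq_star_dotProduct, star_trivial] at h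
  rw [dotProduct_comm x, ← h]
  refine Finset.sum_congr rfl fun i _ => ?_
  have h1 : (A *ᵥ x) ⬝ᵥ ⇑(hA.eigenvectorBasis i)
      = hA.eigenvalues i * (⇑(hA.eigenvectorBasis i) ⬝ᵥ x) := by
    rw [dotProduct_comm, dotProduct_mulVec, ← mulVec_transpose, hAt, hA.mulVec_eigenvectorBasis,
      smul_dotProduct, smul_eq_mul]
  rw [h1]
  ring

open Matrix in
theorem Matrix.IsHermitian.dotProduct_self_eq_sum {V : Type*} [Fintype V] [DecidableEq V]
    {A : Matrix V V ℝ} (hA : A.IsHermitian) (x : V → ℝ) :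
    x ⬝ᵥ x = ∑ i, (⇑(hA.eigenvectorBasis i) ⬝ᵥ x) ^ 2 := by
  have h := hA.eigenvectorBasis.sum_inner_mul_inner (WithLp.toLp 2 x) (WithLp.toLp 2 x)
  simp only [EuclideanSpace.inner_eq_star_dotProduct, star_trivial] at h
  rw [← h]
  refine Finset.sum_congr rfl fun i _ => ?_
  rw [dotProduct_comm x]
  ring

open Matrix in
theorem SimpleGraph.dotProduct_lapMatrix_mulVec {V : Type*} [Fintype V] [DecidableEq V]
    (G : SimpleGraph V) [DecidableRel G.Adj] (x : V → ℝ) :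
    x ⬝ᵥ G.lapMatrix ℝ *ᵥ x = (∑ i, ∑ j, if G.Adj i j then (x i - x j) ^ 2 else 0) / 2 := by
  rw [← G.lapMatrix_toLinearMap₂' ℝ x, toLinearMap₂'_apply']

open Matrix in
/-- The second smallest eigenvalue is at most the Rayleigh quotient of any vector orthogonal
to the constants. -/
theorem algebraicConnectivity_mul_le {V : Type*} [Fintype V] [DecidableEq V]
    (G : SimpleGraph V) [DecidableRel G.Adj] (hV : 2 ≤ Fintype.card V)
    (f : V → ℝ) (hf : ∑ v, f v = 0) :
    algebraicConnectivity G * ∑ v, f v ^ 2 ≤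
      (∑ i, ∑ j, if G.Adj i j then (f i - f j) ^ 2 else 0) / 2 := by
  rw [algebraicConnectivity, dif_pos hV]
  set hA := G.isHermitian_lapMatrix ℝ
  set k : Fin (Fintype.card V) := ⟨Fintype.card V - 2, Nat.sub_lt (by omega) (by omega)⟩
  -- `eigenvalues` is `eigenvalues₀` transported along this equivalence, so `l` indexes the smallest
  -- eigenvalue.
  set l : V := Fintype.equivOfCardEq (Fintype.card_fin _) ⟨Fintype.card V - 1, by omega⟩ with hl
  have hE : 0 ≤ (∑ i, ∑ j, if G.Adj i j then (f i - f j) ^ 2 else 0) / 2 := by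
    refine div_nonneg (Finset.sum_nonneg fun i _ => Finset.sum_nonneg fun j _ => ?_) (by norm_num)
    split_ifs <;> positivity
  have hf2 : 0 ≤ ∑ v, f v ^ 2 := Finset.sum_nonneg fun i _ => sq_nonneg _
  -- A combination of 1 and `f` orthogonal to the bottom eigenvector, so there is no need to know
  -- that this eigenvector is constant.
  obtain ⟨α, β, hne, hab⟩ : ∃ α β : ℝ, (α ≠ 0 ∨ β ≠ 0) ∧
      α * (⇑(hA.eigenvectorBasis l) ⬝ᵥ fun _ => (1 : ℝ)) +
        β * (⇑(hA.eigenvectorBasis l) ⬝ᵥ f) = 0 := by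
    by_cases h : (⇑(hA.eigenvectorBasis l) ⬝ᵥ fun _ => (1 : ℝ)) = 0
    · exact ⟨1, 0, by simp, by simp [h]⟩
    · exact ⟨-(⇑(hA.eigenvectorBasis l) ⬝ᵥ f), _, Or.inr h, by ring⟩
  set w : V → ℝ := fun v => α + β * f v with hw
  have hwl : ⇑(hA.eigenvectorBasis l) ⬝ᵥ w = 0 := by
    rw [← hab]
    simp only [dotProduct, hw, Finset.mul_sum, ← Finset.sum_add_distrib]
    exact Finset.sum_congr rfl fun i _ => by ring
  have hww : w ⬝ᵥ w = α ^ 2 * Fintype.card V + β ^ 2 * ∑ v, f v ^ 2 := by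
    have : ∀ v, w v * w v = α ^ 2 + 2 * α * β * f v + β ^ 2 * f v ^ 2 := fun v => by
      simp only [hw]; ring
    simp only [dotProduct, this, Finset.sum_add_distrib, ← Finset.mul_sum, hf]
    simp [mul_comm]
  have hwL : w ⬝ᵥ G.lapMatrix ℝ *ᵥ w =
      β ^ 2 * ((∑ i, ∑ j, if G.Adj i j then (f i - f j) ^ 2 else 0) / 2) := by
    rw [G.dotProduct_lapMatrix_mulVec, ← mul_div_assoc, Finset.mul_sum]
    congr 1
    refine Finset.sum_congr rfl fun i _ => ?_
    rw [Finset.mul_sum]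
    refine Finset.sum_congr rfl fun j _ => ?_
    split_ifs
    · simp only [hw]; ring
    · simp
  have key : hA.eigenvalues₀ k * (w ⬝ᵥ w) ≤ w ⬝ᵥ G.lapMatrix ℝ *ᵥ w := by
    rw [hA.dotProduct_mulVec_eq_sum, hA.dotProduct_self_eq_sum, Finset.mul_sum]
    refine Finset.sum_le_sum fun i _ => ?_
    by_cases hi : i = l
    · rw [hi, hwl]; simp
    · refine mul_le_mul_of_nonneg_right (hA.eigenvalues₀_antitone ?_) (sq_nonneg _)
      rw [hl, ← Equiv.symm_apply_eq] at hi
      rw [Fin.le_def]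
      have h1 := ((Fintype.equivOfCardEq (Fintype.card_fin (Fintype.card V))).symm i).2
      have h2 : ((Fintype.equivOfCardEq (Fintype.card_fin (Fintype.card V))).symm i).val ≠
          Fintype.card V - 1 := fun h => hi (Fin.ext h)
      simp only [k]
      omega
  rw [hww, hwL] at key
  have hN : (2 : ℝ) ≤ Fintype.card V := by exact_mod_cast hV
  rcases lt_or_ge (hA.eigenvalues₀ k) 0 with h0 | h0
  · exact (mul_nonpos_of_nonpos_of_nonneg h0.le hf2).trans hE
  -- If β = 0, then `w` is a nonzero constant of zero energy, which forces the eigenvalue to be at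
  -- most 0.
  by_cases hβ : β = 0
  · have hα : α ≠ 0 := by tauto
    have h3 : 0 < α ^ 2 * Fintype.card V := by positivity
    have : hA.eigenvalues₀ k ≤ 0 := by
      subst hβ
      by_contra! h
      nlinarith [mul_pos h h3]
    exact (mul_nonpos_of_nonpos_of_nonneg this hf2).trans hE
  · have hb : 0 < β ^ 2 := by positivity
    have h3 : 0 ≤ hA.eigenvalues₀ k * (α ^ 2 * Fintype.card V) := by positivity
    refine le_of_mul_le_mul_left ?_ hb
    linarith

open Matrix in
/-- The second smallest eigenvalue is at least the Rayleigh quotient of some vector orthogonal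
to the constants. -/
theorem exists_rayleigh_le_algebraicConnectivity {V : Type*} [Fintype V] [DecidableEq V]
    (G : SimpleGraph V) [DecidableRel G.Adj] (hV : 2 ≤ Fintype.card V) :
    ∃ f : V → ℝ, ∑ v, f v = 0 ∧ 0 < ∑ v, f v ^ 2 ∧
      (∑ i, ∑ j, if G.Adj i j then (f i - f j) ^ 2 else 0) / 2 ≤
        algebraicConnectivity G * ∑ v, f v ^ 2 := by
  rw [algebraicConnectivity, dif_pos hV]
  set hA := G.isHermitian_lapMatrix ℝ
  set k : Fin (Fintype.card V) := ⟨Fintype.card V - 2, Nat.sub_lt (by omega) (by omega)⟩ with hk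
  set e := Fintype.equivOfCardEq (Fintype.card_fin (Fintype.card V)) with he
  set l : Fin (Fintype.card V) := ⟨Fintype.card V - 1, by omega⟩ with hl
  have hkl : e k ≠ e l := fun h => by
    have := congrArg Fin.val (e.injective h)
    simp only [hk, hl] at this
    omega
  have hon : ∀ i j, ⇑(hA.eigenvectorBasis i) ⬝ᵥ ⇑(hA.eigenvectorBasis j)
      = if i = j then (1 : ℝ) else 0 := fun i j => by
    have := orthonormal_iff_ite.1 hA.eigenvectorBasis.orthonormal j i
    rw [EuclideanSpace.inner_eq_star_dotProduct, star_trivial] at this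
    rw [this]
    simp [eq_comm]
  -- The two bottom eigenvectors span a plane, so it contains a nonzero vector of mean zero.
  obtain ⟨α, β, hne, hab⟩ : ∃ α β : ℝ, (α ≠ 0 ∨ β ≠ 0) ∧
      α * (∑ v, hA.eigenvectorBasis (e k) v) + β * (∑ v, hA.eigenvectorBasis (e l) v) = 0 := by
    by_cases h : (∑ v, hA.eigenvectorBasis (e k) v) = 0
    · exact ⟨1, 0, by simp, by simp [h]⟩
    · exact ⟨-(∑ v, hA.eigenvectorBasis (e l) v), _, Or.inr h, by ring⟩
  set f : V → ℝ := fun v =>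
    α * hA.eigenvectorBasis (e k) v + β * hA.eigenvectorBasis (e l) v with hf
  have hbf : ∀ i, ⇑(hA.eigenvectorBasis i) ⬝ᵥ f =
      α * (if i = e k then 1 else 0) + β * (if i = e l then 1 else 0) := fun i => by
    rw [← hon, ← hon]
    simp only [dotProduct, hf, Finset.mul_sum, ← Finset.sum_add_distrib]
    exact Finset.sum_congr rfl fun i _ => by ring
  have hsplit : ∀ i, (⇑(hA.eigenvectorBasis i) ⬝ᵥ f) ^ 2 =
      (if i = e k then α ^ 2 else 0) + (if i = e l then β ^ 2 else 0) := fun i => by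
    rw [hbf]
    by_cases h1 : i = e k
    · have h2 : i ≠ e l := fun h => hkl (h1.symm.trans h)
      simp [h1, hkl]
    · simp [h1]
  have hff : ∑ v, f v ^ 2 = α ^ 2 + β ^ 2 := by
    have := hA.dotProduct_self_eq_sum f
    simp only [hsplit, Finset.sum_add_distrib, Finset.sum_ite_eq', Finset.mem_univ, if_true] at this
    rw [← this]
    simp [dotProduct, sq]
  refine ⟨f, ?_, ?_, ?_⟩
  · simpa only [hf, Finset.sum_add_distrib, ← Finset.mul_sum] using hab
  · rw [hff]
    rcases hne with h | h <;> positivity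
  · rw [← G.dotProduct_lapMatrix_mulVec, hA.dotProduct_mulVec_eq_sum, hff]
    simp only [hsplit, mul_add, mul_ite, mul_zero, Finset.sum_add_distrib, Finset.sum_ite_eq',
      Finset.mem_univ, if_true]
    have h1 : hA.eigenvalues (e k) = hA.eigenvalues₀ k := by
      simp [Matrix.IsHermitian.eigenvalues, he]
    have h2 : hA.eigenvalues (e l) ≤ hA.eigenvalues₀ k := by
      have : hA.eigenvalues (e l) = hA.eigenvalues₀ l := by
        simp [Matrix.IsHermitian.eigenvalues, he]
      rw [this]
      exact hA.eigenvalues₀_antitone (by rw [Fin.le_def]; simp only [hk, hl]; omega)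
    rw [h1]
    gcongr

/-! ### Spectral gap of the path -/

/-- Dirichlet form of the discrete Laplacian on a path, bounded below by its first eigenvalue. -/
theorem path_dirichlet_poincare {n : ℕ} (hn : 2 ≤ n) (S : ℕ → ℝ) (h0 : S 0 = 0) (hS : S n = 0) :
    (2 - 2 * Real.cos (Real.pi / n)) * ∑ k ∈ Finset.range n, S k ^ 2 ≤
      ∑ k ∈ Finset.range n, (S (k + 1) - S k) ^ 2 := by
  have hn0 : (0 : ℝ) < n := by positivity
  set s : ℕ → ℝ := fun k => Real.sin (Real.pi * k / n) with hs
  have hpos : ∀ k, 0 < k → k < n → 0 < s k := fun k h1 h2 => by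
    have h1' : (0 : ℝ) < k := by exact_mod_cast h1
    have h2' : (k : ℝ) < n := by exact_mod_cast h2
    refine Real.sin_pos_of_pos_of_lt_pi (by positivity) ?_
    rw [div_lt_iff₀ hn0]
    exact mul_lt_mul_of_pos_left h2' Real.pi_pos
  have hs0 : s 0 = 0 := by simp [hs]
  have hsn : s n = 0 := by simp [hs, hn0.ne']
  have hrec : ∀ k, s k + s (k + 2) = 2 * Real.cos (Real.pi / n) * s (k + 1) := fun k => by
    simp only [hs]
    have e1 : Real.pi * (k : ℕ) / n = Real.pi * ((k + 1 : ℕ) : ℝ) / n - Real.pi / n := by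
      push_cast; field_simp; ring
    have e2 : Real.pi * ((k + 2 : ℕ) : ℝ) / n = Real.pi * ((k + 1 : ℕ) : ℝ) / n + Real.pi / n := by
      push_cast; field_simp; ring
    rw [e1, e2, Real.sin_sub, Real.sin_add]
    ring
  -- Picone's inequality against the positive ground state `s`. At both ends the quotient with zero
  -- denominator is multiplied by a vanishing value of `S`.
  have hterm : ∀ k ∈ Finset.range n, S (k + 1) ^ 2 * (1 - s k / s (k + 1)) +
      S k ^ 2 * (1 - s (k + 1) / s k) ≤ (S (k + 1) - S k) ^ 2 := fun k hk => by
    have hk := Finset.mem_range.1 hk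
    rcases Nat.eq_zero_or_pos k with rfl | hk0
    · simp [h0, hs0]
    rcases eq_or_ne (k + 1) n with hkn | hkn
    · rw [hkn, hS, hsn]; simp
    have p1 := hpos k hk0 hk
    have p2 := hpos (k + 1) (by omega) (by omega)
    have : (S (k + 1) - S k) ^ 2 - (S (k + 1) ^ 2 * (1 - s k / s (k + 1)) +
        S k ^ 2 * (1 - s (k + 1) / s k)) =
        s k * s (k + 1) * (S k / s k - S (k + 1) / s (k + 1)) ^ 2 := by
      field_simp
      ring
    have h2 : 0 ≤ s k * s (k + 1) * (S k / s k - S (k + 1) / s (k + 1)) ^ 2 := by positivity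
    linarith
  -- After regrouping, S(k+1)² has coefficient 2 - (s(k) + s(k+2))/s(k+1), which is the eigenvalue
  -- by `hrec`.
  refine le_trans (le_of_eq ?_) (Finset.sum_le_sum hterm)
  obtain ⟨m, rfl⟩ : ∃ m, n = m + 1 := ⟨n - 1, by omega⟩
  rw [Finset.sum_add_distrib, Finset.sum_range_succ (fun k => S (k + 1) ^ 2 * (1 - s k / s (k + 1))),
    hS, Finset.sum_range_succ' (fun k => S k ^ 2 * (1 - s (k + 1) / s k)),
    Finset.sum_range_succ' (fun k => S k ^ 2), h0]
  simp only [ne_eq, OfNat.ofNat_ne_zero, not_false_eq_true, zero_pow, zero_mul, add_zero,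
    Finset.mul_sum, ← Finset.sum_add_distrib]
  refine Finset.sum_congr rfl fun k hk => ?_
  have hk := Finset.mem_range.1 hk
  have p := hpos (k + 1) (by omega) (by omega)
  have := hrec k
  have e : s (k + 1 + 1) = 2 * Real.cos (Real.pi / (m + 1 : ℕ)) * s (k + 1) - s k := by
    linarith
  rw [e]
  field_simp
  ring

/-- The spectral gap of the path on `n` vertices. -/
theorem path_poincare {n : ℕ} (hn : 2 ≤ n) (y : ℕ → ℝ)
    (hy : ∑ j ∈ Finset.range n, y j = 0) :
    (2 - 2 * Real.cos (Real.pi / n)) * ∑ j ∈ Finset.range n, y j ^ 2 ≤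
      ∑ j ∈ Finset.range (n - 1), (y (j + 1) - y j) ^ 2 := by
  set S : ℕ → ℝ := fun k => ∑ j ∈ Finset.range k, y j with hSdef
  have hsucc : ∀ k, S (k + 1) - S k = y k := fun k => by simp [hSdef, Finset.sum_range_succ]
  have hD := path_dirichlet_poincare hn S (by simp [hSdef]) hy
  simp only [hsucc] at hD
  obtain ⟨m, rfl⟩ : ∃ m, n = m + 1 := ⟨n - 1, by omega⟩
  -- Summation by parts. The partial sums `S` vanish at 0 and `n`, so the Dirichlet bound applies to
  -- them, and Cauchy–Schwarz carries it over to `y`.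
  have habel : ∀ m, ∑ j ∈ Finset.range (m + 1), y j ^ 2 =
      S (m + 1) * y m - ∑ j ∈ Finset.range m, S (j + 1) * (y (j + 1) - y j) := fun m => by
    induction m with
    | zero => simp [hSdef, sq]
    | succ m ih =>
      rw [Finset.sum_range_succ, ih, Finset.sum_range_succ]
      have := hsucc (m + 1)
      linear_combination (-y (m + 1)) * this
  have hAb := habel m
  rw [show S (m + 1) = 0 from hy, zero_mul, zero_sub] at hAb
  rw [Finset.sum_range_succ' (fun k => S k ^ 2), show S 0 = 0 by simp [hSdef]] at hD
  simp only [ne_eq, OfNat.ofNat_ne_zero, not_false_eq_true, zero_pow, add_zero] at hD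
  have hCS := Finset.sum_mul_sq_le_sq_mul_sq (Finset.range m) (fun j => S (j + 1))
    (fun j => y (j + 1) - y j)
  have hsq : (∑ j ∈ Finset.range m, S (j + 1) * (y (j + 1) - y j)) ^ 2 =
      (∑ j ∈ Finset.range (m + 1), y j ^ 2) ^ 2 := by rw [hAb]; ring
  rw [hsq] at hCS
  simp only [Nat.add_sub_cancel]
  set Y := ∑ j ∈ Finset.range (m + 1), y j ^ 2
  set D := ∑ j ∈ Finset.range m, (y (j + 1) - y j) ^ 2
  set T := ∑ j ∈ Finset.range m, S (j + 1) ^ 2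
  have hY : 0 ≤ Y := Finset.sum_nonneg fun _ _ => sq_nonneg _
  have hDn : 0 ≤ D := Finset.sum_nonneg fun _ _ => sq_nonneg _
  have hl : 0 ≤ 2 - 2 * Real.cos (Real.pi / (m + 1 : ℕ)) := by
    linarith [Real.cos_le_one (Real.pi / (m + 1 : ℕ))]
  rcases hY.eq_or_lt with h | h
  · rw [← h, mul_zero]; exact hDn
  · refine le_of_mul_le_mul_right ?_ h
    calc _ = (2 - 2 * Real.cos (Real.pi / (m + 1 : ℕ))) * Y ^ 2 := by ring
      _ ≤ (2 - 2 * Real.cos (Real.pi / (m + 1 : ℕ))) * (T * D) := by gcongr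
      _ = ((2 - 2 * Real.cos (Real.pi / (m + 1 : ℕ))) * T) * D := by ring
      _ ≤ Y * D := by gcongr
      _ = D * Y := by ring

/-! ### Edge cuts along a linear order of the vertices -/

/-- The adjacency matrix of a connected cubic bipartite (multi)graph on the vertices
`0, …, N - 1`, where `s` is the sign of the bipartition. -/
structure IsCubicBipartiteMatrix (N : ℕ) (A : ℕ → ℕ → ℤ) (s : ℕ → ℤ) : Prop where
  nonneg : ∀ i j, 0 ≤ A i j
  symm : ∀ i j, A i j = A j i
  sign : ∀ i, s i = 1 ∨ s i = -1
  bipartite : ∀ i j, A i j ≠ 0 → s i = -s j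
  row : ∀ i < N, ∑ j ∈ Finset.range N, A i j = 3
  connected : ∀ k, 0 < k → k < N → ∃ i < k, ∃ j < N, k ≤ j ∧ A i j ≠ 0

/-- The number of edges between the first `k` vertices and the others. -/
def edgeCut (N : ℕ) (A : ℕ → ℕ → ℤ) (k : ℕ) : ℤ :=
  ∑ i ∈ Finset.range N, ∑ j ∈ Finset.range N, if i < k ∧ k ≤ j then A i j else 0

/-- The number of edges between the vertices before `k` and the vertices after `k`. -/
def edgesOver (N : ℕ) (A : ℕ → ℕ → ℤ) (k : ℕ) : ℤ :=
  ∑ i ∈ Finset.range N, ∑ j ∈ Finset.range N, if i < k ∧ k < j then A i j else 0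

theorem Finset.sum_range_ite_lt {M : Type*} [AddCommMonoid M] {N k : ℕ} (hk : k ≤ N) (f : ℕ → M) :
    ∑ i ∈ Finset.range N, (if i < k then f i else 0) = ∑ i ∈ Finset.range k, f i := by
  rw [← Finset.sum_filter]
  congr 1
  ext i
  simp only [Finset.mem_filter, Finset.mem_range]
  omega

namespace IsCubicBipartiteMatrix

variable {N : ℕ} {A : ℕ → ℕ → ℤ} {s : ℕ → ℤ}

/-- The signed row sums of the first `k` vertices total three times their signs. Edges inside that
set join opposite signs and cancel, so only the cut remains. -/
theorem signed_cut (h : IsCubicBipartiteMatrix N A s) {k : ℕ} (hk : k ≤ N) :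
    ∑ i ∈ Finset.range N, ∑ j ∈ Finset.range N, (if i < k ∧ k ≤ j then s i * A i j else 0) =
      3 * ∑ i ∈ Finset.range k, s i := by
  have hanti : ∀ i j, s i * A i j = -(s j * A j i) := fun i j => by
    by_cases h0 : A i j = 0
    · rw [← h.symm i j, h0]; simp
    · rw [← h.symm i j, h.bipartite i j h0]; ring
  have hin : ∑ i ∈ Finset.range N, ∑ j ∈ Finset.range N,
      (if i < k ∧ j < k then s i * A i j else 0) = 0 := by
    have h1 : ∑ i ∈ Finset.range N, ∑ j ∈ Finset.range N,
        (if i < k ∧ j < k then s i * A i j else 0) = -∑ i ∈ Finset.range N, ∑ j ∈ Finset.range N,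
        (if i < k ∧ j < k then s i * A i j else 0) := by
      conv_lhs => rw [Finset.sum_comm]
      simp only [← Finset.sum_neg_distrib]
      refine Finset.sum_congr rfl fun i _ => Finset.sum_congr rfl fun j _ => ?_
      rw [hanti j i]
      simp only [and_comm]
      split_ifs <;> simp
    omega
  refine ((congrArg _ hin).trans (add_zero _)).symm.trans ?_
  rw [← Finset.sum_add_distrib, ← Finset.sum_range_ite_lt hk, Finset.mul_sum]
  refine Finset.sum_congr rfl fun i hi => ?_
  rw [← Finset.sum_add_distrib]
  split_ifs with hik
  · rw [← h.row i (Finset.mem_range.1 hi), Finset.sum_mul]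
    refine Finset.sum_congr rfl fun j _ => ?_
    rcases lt_or_ge j k with hj | hj
    · simp [hik, hj, mul_comm]
    · simp [hik, hj, hj.not_gt, mul_comm]
  · simp [hik]

theorem abs_three_mul_le_edgeCut (h : IsCubicBipartiteMatrix N A s) {k : ℕ} (hk : k ≤ N) :
    |3 * ∑ i ∈ Finset.range k, s i| ≤ edgeCut N A k := by
  rw [← h.signed_cut hk]
  refine (Finset.abs_sum_le_sum_abs _ _).trans (Finset.sum_le_sum fun i _ => ?_)
  refine (Finset.abs_sum_le_sum_abs _ _).trans (Finset.sum_le_sum fun j _ => ?_)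
  split_ifs
  · rw [abs_mul, abs_of_nonneg (h.nonneg i j)]
    rcases h.sign i with e | e <;> simp [e]
  · simp

/-- Signs are odd, so modulo 2 the cut agrees with its signed count 3∑s, hence with `k`. -/
theorem even_edgeCut_sub (h : IsCubicBipartiteMatrix N A s) {k : ℕ} (hk : k ≤ N) :
    (2 : ℤ) ∣ edgeCut N A k - k := by
  have h1 : (2 : ℤ) ∣ edgeCut N A k - 3 * ∑ i ∈ Finset.range k, s i := by
    rw [← h.signed_cut hk, edgeCut, ← Finset.sum_sub_distrib]
    refine Finset.dvd_sum fun i _ => ?_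
    rw [← Finset.sum_sub_distrib]
    refine Finset.dvd_sum fun j _ => ?_
    split_ifs
    · rcases h.sign i with e | e <;> simp [e]
      omega
    · simp
  have h2 : (2 : ℤ) ∣ ∑ i ∈ Finset.range k, s i - k := by
    have : ∑ i ∈ Finset.range k, s i - k = ∑ i ∈ Finset.range k, (s i - 1) := by simp
    rw [this]
    refine Finset.dvd_sum fun i _ => ?_
    rcases h.sign i with e | e <;> simp [e]
  omega

theorem edgeCut_pos (h : IsCubicBipartiteMatrix N A s) {k : ℕ} (hk0 : 0 < k) (hk : k < N) :
    0 < edgeCut N A k := by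
  obtain ⟨i, hi, j, hjN, hj, hA⟩ := h.connected k hk0 hk
  have hnn : ∀ i j, 0 ≤ if i < k ∧ k ≤ j then A i j else 0 := fun i j => by
    split_ifs
    exacts [h.nonneg i j, le_rfl]
  have hij : 0 < A i j := lt_of_le_of_ne (h.nonneg i j) (Ne.symm hA)
  refine Finset.sum_pos' (fun i _ => Finset.sum_nonneg fun j _ => hnn i j)
    ⟨i, Finset.mem_range.2 (by omega), Finset.sum_pos' (fun j _ => hnn i j)
      ⟨j, Finset.mem_range.2 hjN, by simpa [hi, hj] using hij⟩⟩

theorem two_le_edgeCut (h : IsCubicBipartiteMatrix N A s) {k : ℕ} (hk0 : 0 < k) (hk : k < N)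
    (he : Even k) : 2 ≤ edgeCut N A k := by
  have h1 := h.edgeCut_pos hk0 hk
  have h2 := h.even_edgeCut_sub hk.le
  obtain ⟨m, rfl⟩ := he
  push_cast at h2
  omega

/-- A sum of oddly many signs is odd, hence nonzero, and the cut is at least three times its
absolute value. -/
theorem three_le_edgeCut (h : IsCubicBipartiteMatrix N A s) {k : ℕ} (hk : k ≤ N)
    (ho : Odd k) : 3 ≤ edgeCut N A k := by
  have h1 := h.abs_three_mul_le_edgeCut hk
  have h2 := h.even_edgeCut_sub hk
  obtain ⟨m, rfl⟩ := ho
  have h3 : (2 : ℤ) ∣ ∑ i ∈ Finset.range (2 * m + 1), s i - (2 * m + 1 : ℕ) := by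
    have : ∑ i ∈ Finset.range (2 * m + 1), s i - (2 * m + 1 : ℕ) =
      ∑ i ∈ Finset.range (2 * m + 1), (s i - 1) := by simp
    rw [this]
    refine Finset.dvd_sum fun i _ => ?_
    rcases h.sign i with e | e <;> simp [e]
  push_cast at h3
  have := abs_le.1 h1
  omega

/-- An edge passing over `k` lies in both cuts; each of the three edges at `k` lies in exactly one.
-/
theorem edgeCut_add_edgeCut_succ (h : IsCubicBipartiteMatrix N A s) {k : ℕ} (hk : k < N) :
    edgeCut N A k + edgeCut N A (k + 1) = 2 * edgesOver N A k + 3 := by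
  have hdiag : A k k = 0 := by
    by_contra h0
    have := h.bipartite k k h0
    rcases h.sign k with e | e <;> omega
  have hmem : k ∈ Finset.range N := Finset.mem_range.2 hk
  have h1 : edgeCut N A k = edgesOver N A k +
      ∑ i ∈ Finset.range N, if i < k then A k i else 0 := by
    rw [edgeCut, edgesOver, ← Finset.sum_add_distrib]
    refine Finset.sum_congr rfl fun i _ => ?_
    have : (if i < k then A k i else 0) = ∑ j ∈ Finset.range N,
        if j = k then (if i < k then A i j else 0) else 0 := by
      rw [Finset.sum_ite_eq' _ k, if_pos hmem, h.symm k i]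
    rw [this, ← Finset.sum_add_distrib]
    refine Finset.sum_congr rfl fun j _ => ?_
    grind
  have h2 : edgeCut N A (k + 1) = edgesOver N A k +
      ∑ j ∈ Finset.range N, if k < j then A k j else 0 := by
    have : ∑ j ∈ Finset.range N, (if k < j then A k j else 0) = ∑ i ∈ Finset.range N,
        if i = k then (∑ j ∈ Finset.range N, if k < j then A i j else 0) else 0 := by
      rw [Finset.sum_ite_eq' _ k, if_pos hmem]
    rw [edgeCut, edgesOver, this, ← Finset.sum_add_distrib]
    refine Finset.sum_congr rfl fun i _ => ?_
    split_ifs with hi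
    · rw [← Finset.sum_add_distrib]
      refine Finset.sum_congr rfl fun j _ => ?_
      grind
    · rw [add_zero]
      refine Finset.sum_congr rfl fun j _ => ?_
      grind
  have h3 : (∑ i ∈ Finset.range N, if i < k then A k i else 0) +
      (∑ j ∈ Finset.range N, if k < j then A k j else 0) = 3 := by
    rw [← h.row k hk, ← Finset.sum_add_distrib]
    refine Finset.sum_congr rfl fun j _ => ?_
    rcases lt_trichotomy j k with hj | rfl | hj
    · simp [hj, hj.le]
    · simp [hdiag]
    · simp [hj, hj.le]
  omega

/-- One of the two adjacent cuts is at least 3 and the other at least 2, so their sum exceeds the 3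
edges at `k`. -/
theorem one_le_edgesOver (h : IsCubicBipartiteMatrix N A s) {k : ℕ} (hk0 : 0 < k)
    (hk : k + 1 < N) : 1 ≤ edgesOver N A k := by
  have h1 := h.edgeCut_add_edgeCut_succ (k := k) (by omega)
  rcases Nat.even_or_odd k with he | ho
  · have h2 := h.two_le_edgeCut hk0 (by omega) he
    have h3 := h.three_le_edgeCut (k := k + 1) (by omega) he.add_one
    omega
  · have h2 := h.three_le_edgeCut (k := k) (by omega) ho
    have h3 := h.two_le_edgeCut (k := k + 1) (by omega) hk ho.add_one
    omega

end IsCubicBipartiteMatrix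

/-! ### Energy of monotone functions and the lower bound -/

/-- A square of an increment dominates the squares of the consecutive gaps together with the
products of neighbouring gaps. -/
theorem Monotone.sum_sq_gaps_le {x : ℕ → ℝ} (hx : Monotone x) {i j : ℕ} (hij : i ≤ j) :
    ∑ l ∈ Finset.Ico i (j + 1), (x (l + 1) - x l) ^ 2 +
      2 * ∑ l ∈ Finset.Ico i j, (x (l + 1) - x l) * (x (l + 2) - x (l + 1)) ≤
      (x (j + 1) - x i) ^ 2 := by
  induction j, hij using Nat.le_induction with
  | base => simp
  | succ j hij ih =>
    rw [Finset.sum_Ico_succ_top (by omega : i ≤ j + 1), Finset.sum_Ico_succ_top hij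
      (fun l => (x (l + 1) - x l) * (x (l + 2) - x (l + 1)))]
    have h1 := hx hij
    have h2 := hx (Nat.le_succ (j + 1))
    simp only [Nat.succ_eq_add_one] at h2
    nlinarith [mul_nonneg (sub_nonneg.2 h1) (sub_nonneg.2 h2)]

theorem Finset.sum_Ico_eq_sum_range_ite {M : Type*} [AddCommMonoid M] {N a b : ℕ} (hb : b ≤ N)
    (f : ℕ → M) : ∑ l ∈ Finset.Ico a b, f l =
      ∑ l ∈ Finset.range N, if a ≤ l ∧ l < b then f l else 0 := by
  rw [← Finset.sum_filter]
  congr 1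
  ext i
  simp only [Finset.mem_filter, Finset.mem_range, Finset.mem_Ico]
  omega

/-- The energy of a monotone function, in terms of its gaps and the cuts. -/
theorem Monotone.sum_edgeCut_le {x : ℕ → ℝ} (hx : Monotone x) (N : ℕ) {A : ℕ → ℕ → ℤ}
    (hA : ∀ i j, 0 ≤ A i j) :
    ∑ l ∈ Finset.range N, (x (l + 1) - x l) ^ 2 * edgeCut N A (l + 1) +
      2 * ∑ l ∈ Finset.range N, (x (l + 1) - x l) * (x (l + 2) - x (l + 1)) *
        edgesOver N A (l + 1) ≤
    ∑ i ∈ Finset.range N, ∑ j ∈ Finset.range N,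
      if i < j then (A i j : ℝ) * (x j - x i) ^ 2 else 0 := by
  -- Exchanging sums turns weights per gap into contributions per edge; a general `P` serves both
  -- kinds of count.
  have h1 : ∀ (f : ℕ → ℝ) (P : ℕ → ℕ → ℕ → Prop) [∀ i j l, Decidable (P i j l)],
      ∑ l ∈ Finset.range N, f l * ((∑ i ∈ Finset.range N, ∑ j ∈ Finset.range N,
        if P i j l then A i j else 0 : ℤ) : ℝ) =
      ∑ i ∈ Finset.range N, ∑ j ∈ Finset.range N, (A i j : ℝ) *
        ∑ l ∈ Finset.range N, if P i j l then f l else 0 := fun f P _ => by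
    simp only [Int.cast_sum, Finset.mul_sum]
    rw [Finset.sum_comm]
    refine Finset.sum_congr rfl fun i _ => ?_
    rw [Finset.sum_comm]
    refine Finset.sum_congr rfl fun j _ => Finset.sum_congr rfl fun l _ => ?_
    split_ifs <;> simp [mul_comm]
  simp only [edgeCut, edgesOver]
  rw [h1 _ (fun i j l => i < l + 1 ∧ l + 1 ≤ j), h1 _ (fun i j l => i < l + 1 ∧ l + 1 < j),
    Finset.mul_sum, ← Finset.sum_add_distrib]
  refine Finset.sum_le_sum fun i _ => ?_
  rw [Finset.mul_sum, ← Finset.sum_add_distrib]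
  refine Finset.sum_le_sum fun j hj => ?_
  have hjN := Finset.mem_range.1 hj
  split_ifs with hij
  · obtain ⟨m, rfl⟩ : ∃ m, j = m + 1 := ⟨j - 1, by omega⟩
    have h2 := hx.sum_sq_gaps_le (show i ≤ m by omega)
    rw [Finset.sum_Ico_eq_sum_range_ite hjN.le,
      Finset.sum_Ico_eq_sum_range_ite (show m ≤ N by omega)] at h2
    simp only [Nat.lt_succ_iff, Nat.succ_le_iff] at h2 ⊢
    have h3 : (0 : ℝ) ≤ A i (m + 1) := by exact_mod_cast hA _ _
    have := mul_le_mul_of_nonneg_left h2 h3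
    linarith
  · have : ∀ l, ¬(i < l + 1 ∧ l + 1 ≤ j) := fun l => by omega
    have h' : ∀ l, ¬(i < l + 1 ∧ l + 1 < j) := fun l => by omega
    simp only [this, h', if_false, Finset.sum_const_zero, mul_zero, add_zero, le_refl]

/-- Comparison of the gap form with weights `3, 2, 3, …, 3` with the Dirichlet form of the
path of midpoints of consecutive pairs. -/
theorem Monotone.path_form_le {x : ℕ → ℝ} (hx : Monotone x) (m : ℕ) :
    2 * ∑ j ∈ Finset.range m,
        ((x (2 * j + 2) + x (2 * j + 3)) / 2 - (x (2 * j) + x (2 * j + 1)) / 2) ^ 2 +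
      ∑ j ∈ Finset.range (m + 1), (x (2 * j + 1) - x (2 * j)) ^ 2 +
      (x (2 * m + 1) - x (2 * m)) ^ 2 ≤
    ∑ l ∈ Finset.range (2 * m + 1), (if Even l then 3 else 2) * (x (l + 1) - x l) ^ 2 +
      2 * ∑ l ∈ Finset.range (2 * m), (x (l + 1) - x l) * (x (l + 2) - x (l + 1)) := by
  induction m with
  | zero => simp; nlinarith [sq_nonneg (x 1 - x 0)]
  | succ m ih =>
    rw [show 2 * (m + 1) + 1 = 2 * m + 1 + 1 + 1 by ring, show 2 * (m + 1) = 2 * m + 1 + 1 by ring,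
      Finset.sum_range_succ _ m, Finset.sum_range_succ _ (m + 1),
      Finset.sum_range_succ _ (2 * m + 1 + 1), Finset.sum_range_succ _ (2 * m + 1),
      Finset.sum_range_succ (fun l => (x (l + 1) - x l) * (x (l + 2) - x (l + 1))) (2 * m + 1),
      Finset.sum_range_succ (fun l => (x (l + 1) - x l) * (x (l + 2) - x (l + 1))) (2 * m)]
    have e1 : ¬Even (2 * m + 1) := by simp
    have e2 : Even (2 * m + 1 + 1) := by simp [Nat.even_add_one]
    rw [if_neg e1, if_pos e2]
    simp only [show 2 * (m + 1) = 2 * m + 2 by ring, add_assoc, Nat.reduceAdd]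
    have h1 := hx (show 2 * m ≤ 2 * m + 1 by omega)
    have h3 := hx (show 2 * m + 2 ≤ 2 * m + 3 by omega)
    -- For successive gaps a, b, c: 2(a/2 + b + c/2)² = a² + 2b² + c² + 2ab + 2bc - (a - c)²/2. A
    -- pair gap thus pays once to each side, leaving one of its three squares; the extra last square
    -- in the statement is what the last pair reserves for the next step.
    nlinarith [sq_nonneg ((x (2 * m + 1) - x (2 * m)) - (x (2 * m + 3) - x (2 * m + 2)))]

/-- The gap inside a pair follows an odd number of vertices and has weight at least 3, the gap
between pairs at least 2, and each product of neighbouring gaps at least one passing edge. -/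
theorem IsCubicBipartiteMatrix.path_form_le_energy {m : ℕ} {A : ℕ → ℕ → ℤ} {s : ℕ → ℤ}
    (h : IsCubicBipartiteMatrix (2 * m + 2) A s) {x : ℕ → ℝ} (hx : Monotone x) :
    2 * ∑ j ∈ Finset.range m,
        ((x (2 * j + 2) + x (2 * j + 3)) / 2 - (x (2 * j) + x (2 * j + 1)) / 2) ^ 2 +
      ∑ j ∈ Finset.range (m + 1), (x (2 * j + 1) - x (2 * j)) ^ 2 ≤
    ∑ i ∈ Finset.range (2 * m + 2), ∑ j ∈ Finset.range (2 * m + 2),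
      if i < j then (A i j : ℝ) * (x j - x i) ^ 2 else 0 := by
  have hg : ∀ l, 0 ≤ x (l + 1) - x l := fun l => sub_nonneg.2 (hx (Nat.le_succ l))
  have hc : ∀ k, 0 ≤ edgeCut (2 * m + 2) A k := fun k =>
    Finset.sum_nonneg fun i _ => Finset.sum_nonneg fun j _ => by
      split_ifs
      exacts [h.nonneg i j, le_rfl]
  have ho : ∀ k, 0 ≤ edgesOver (2 * m + 2) A k := fun k =>
    Finset.sum_nonneg fun i _ => Finset.sum_nonneg fun j _ => by
      split_ifs
      exacts [h.nonneg i j, le_rfl]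
  refine le_trans ?_ (hx.sum_edgeCut_le (2 * m + 2) h.nonneg)
  have h0 := hx.path_form_le m
  have h1 : ∑ l ∈ Finset.range (2 * m + 1), (if Even l then 3 else 2) * (x (l + 1) - x l) ^ 2 ≤
      ∑ l ∈ Finset.range (2 * m + 2), (x (l + 1) - x l) ^ 2 * edgeCut (2 * m + 2) A (l + 1) := by
    rw [Finset.sum_range_succ _ (2 * m + 1)]
    refine le_add_of_le_of_nonneg (Finset.sum_le_sum fun l hl => ?_)
      (mul_nonneg (sq_nonneg _) (by exact_mod_cast hc _))
    have hl := Finset.mem_range.1 hl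
    rw [mul_comm]
    refine mul_le_mul_of_nonneg_left ?_ (sq_nonneg _)
    split_ifs with he
    · exact_mod_cast h.three_le_edgeCut (k := l + 1) (by omega) he.add_one
    · exact_mod_cast h.two_le_edgeCut (k := l + 1) (by omega) (by omega)
        (Nat.not_even_iff_odd.1 he).add_one
  have h2 : ∑ l ∈ Finset.range (2 * m), (x (l + 1) - x l) * (x (l + 2) - x (l + 1)) ≤
      ∑ l ∈ Finset.range (2 * m + 2), (x (l + 1) - x l) * (x (l + 2) - x (l + 1)) *
        edgesOver (2 * m + 2) A (l + 1) := by
    have hnn : ∀ l, 0 ≤ (x (l + 1) - x l) * (x (l + 2) - x (l + 1)) *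
        edgesOver (2 * m + 2) A (l + 1) := fun l =>
      mul_nonneg (mul_nonneg (hg l) (hg (l + 1))) (by exact_mod_cast ho _)
    rw [Finset.sum_range_succ _ (2 * m + 1), Finset.sum_range_succ _ (2 * m)]
    refine le_add_of_le_of_nonneg (le_add_of_le_of_nonneg (Finset.sum_le_sum fun l hl => ?_)
      (hnn _)) (hnn _)
    have hl := Finset.mem_range.1 hl
    refine le_mul_of_one_le_right (mul_nonneg (hg l) (hg (l + 1))) ?_
    exact_mod_cast h.one_le_edgesOver (k := l + 1) (by omega) (by omega)
  linarith [sq_nonneg (x (2 * m + 1) - x (2 * m))]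

theorem Finset.sum_range_two_mul {M : Type*} [AddCommMonoid M] (F : ℕ → M) (n : ℕ) :
    ∑ i ∈ Finset.range (2 * n), F i = ∑ j ∈ Finset.range n, (F (2 * j) + F (2 * j + 1)) := by
  induction n with
  | zero => simp
  | succ n ih =>
    rw [show 2 * (n + 1) = 2 * n + 1 + 1 by ring, Finset.sum_range_succ, Finset.sum_range_succ,
      Finset.sum_range_succ, ih, add_assoc]

theorem sum_sum_ite_lt_of_symm (N : ℕ) (q : ℕ → ℕ → ℝ) (hq : ∀ i j, q i j = q j i)
    (hd : ∀ i, q i i = 0) :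
    (∑ i ∈ Finset.range N, ∑ j ∈ Finset.range N, q i j) / 2 =
      ∑ i ∈ Finset.range N, ∑ j ∈ Finset.range N, if i < j then q i j else 0 := by
  have h1 : ∑ i ∈ Finset.range N, ∑ j ∈ Finset.range N, q i j =
      (∑ i ∈ Finset.range N, ∑ j ∈ Finset.range N, if i < j then q i j else 0) +
      ∑ i ∈ Finset.range N, ∑ j ∈ Finset.range N, if j < i then q j i else 0 := by
    rw [← Finset.sum_add_distrib]
    refine Finset.sum_congr rfl fun i _ => ?_
    rw [← Finset.sum_add_distrib]
    refine Finset.sum_congr rfl fun j _ => ?_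
    rcases lt_trichotomy i j with h | rfl | h
    · simp [h, h.not_gt]
    · simp [hd]
    · simp [h, h.not_gt, hq i j]
  rw [h1, Finset.sum_comm (f := fun i j => if j < i then q j i else 0)]
  ring

/-- Numerical consequence of the energy comparison: an upper bound for the spectral gap of the
path is a lower bound for the energy of monotone functions of mean zero. -/
theorem IsCubicBipartiteMatrix.gap_mul_le_energy {n : ℕ} (hn : 2 ≤ n) {A : ℕ → ℕ → ℤ}
    {s : ℕ → ℤ} (h : IsCubicBipartiteMatrix (2 * n) A s) {x : ℕ → ℝ} (hx : Monotone x)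
    (hx0 : ∑ i ∈ Finset.range (2 * n), x i = 0) :
    (2 - 2 * Real.cos (Real.pi / n)) * ∑ i ∈ Finset.range (2 * n), x i ^ 2 ≤
      ∑ i ∈ Finset.range (2 * n), ∑ j ∈ Finset.range (2 * n),
        if i < j then (A i j : ℝ) * (x j - x i) ^ 2 else 0 := by
  obtain ⟨m, rfl⟩ : ∃ m, n = m + 1 := ⟨n - 1, by omega⟩
  set lam := 2 - 2 * Real.cos (Real.pi / (m + 1 : ℕ)) with hlam
  -- This lets the energy within pairs absorb their share of the norm in `h3`.
  have hlam2 : lam ≤ 2 := by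
    have : 0 ≤ Real.cos (Real.pi / (m + 1 : ℕ)) := by
      refine Real.cos_nonneg_of_neg_pi_div_two_le_of_le ?_ ?_
      · have : 0 ≤ Real.pi / (m + 1 : ℕ) := by positivity
        linarith [Real.pi_pos]
      · exact div_le_div_of_nonneg_left Real.pi_pos.le (by norm_num) (by exact_mod_cast hn)
    linarith
  have h1 := h.path_form_le_energy hx
  rw [show 2 * (m + 1) = 2 * m + 2 by ring] at *
  have h2 := path_poincare hn (fun j => (x (2 * j) + x (2 * j + 1)) / 2) (by
    rw [← Finset.sum_div, ← Finset.sum_range_two_mul,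
      show 2 * (m + 1) = 2 * m + 2 by ring, hx0, zero_div])
  simp only [Nat.add_sub_cancel, show ∀ j, 2 * (j + 1) = 2 * j + 2 from fun j => by ring,
    add_assoc, Nat.reduceAdd] at h2 h1
  have h3 : ∑ i ∈ Finset.range (2 * m + 2), x i ^ 2 =
      2 * ∑ j ∈ Finset.range (m + 1), ((x (2 * j) + x (2 * j + 1)) / 2) ^ 2 +
      (∑ j ∈ Finset.range (m + 1), (x (2 * j + 1) - x (2 * j)) ^ 2) / 2 := by
    rw [show 2 * m + 2 = 2 * (m + 1) by ring, Finset.sum_range_two_mul, Finset.mul_sum,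
      Finset.sum_div, ← Finset.sum_add_distrib]
    exact Finset.sum_congr rfl fun j _ => by ring
  have h4 : 0 ≤ ∑ j ∈ Finset.range (m + 1), (x (2 * j + 1) - x (2 * j)) ^ 2 :=
    Finset.sum_nonneg fun _ _ => sq_nonneg _
  rw [h3]
  nlinarith [mul_le_mul_of_nonneg_right hlam2 h4]

/-- The algebraic connectivity of a connected cubic bipartite graph on `2n` vertices is at least
the spectral gap of the path on `n` vertices. -/
theorem SimpleGraph.Connected.gap_le_algebraicConnectivity {n : ℕ} (hn : 2 ≤ n)
    {G : SimpleGraph (Fin (2 * n))} [DecidableRel G.Adj] (hG : G.Connected)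
    (h3 : G.IsRegularOfDegree 3) (hb : G.IsBipartite) :
    2 - 2 * Real.cos (Real.pi / n) ≤ algebraicConnectivity G := by
  obtain ⟨f, hf0, hfpos, hfE⟩ := exists_rayleigh_le_algebraicConnectivity G (by simp; omega)
  obtain ⟨c⟩ := hb
  set σ := Tuple.sort f
  have hσ : Monotone (f ∘ σ) := Tuple.monotone_sort f
  -- The sorted enumeration is frozen past its last index, so that `f ∘ t` is monotone on all of ℕ.
  set t : ℕ → Fin (2 * n) := fun i => σ ⟨min i (2 * n - 1), by omega⟩ with ht
  have htσ : ∀ i : Fin (2 * n), t i = σ i := fun i => by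
    simp only [ht]
    congr 1
    ext
    simp only
    omega
  have hsum : ∀ {M : Type} [AddCommMonoid M] (F : Fin (2 * n) → M),
      ∑ i ∈ Finset.range (2 * n), F (t i) = ∑ v, F v := fun F => by
    rw [Finset.sum_range (fun i => F (t i))]
    simp only [htσ]
    exact Equiv.sum_comp σ F
  set A : ℕ → ℕ → ℤ := fun i j => if G.Adj (t i) (t j) then 1 else 0 with hA
  set s : ℕ → ℤ := fun i => if c (t i) = 0 then 1 else -1 with hs
  have hmat : IsCubicBipartiteMatrix (2 * n) A s := by
    refine ⟨fun i j => ?_, fun i j => ?_, fun i => ?_, fun i j hij => ?_, fun i _ => ?_,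
      fun k hk0 hk => ?_⟩
    · simp only [hA]; split_ifs <;> simp
    · simp only [hA, G.adj_comm]
    · simp only [hs]; split_ifs <;> simp
    · have hadj : G.Adj (t i) (t j) := by
        by_contra h
        exact hij (if_neg h)
      have := c.valid hadj
      simp only [hs]
      generalize c (t i) = a at *
      generalize c (t j) = b at *
      fin_cases a <;> fin_cases b <;> simp_all
    · simp only [hA]
      rw [hsum (fun v => if G.Adj (t i) v then (1 : ℤ) else 0),
        ← G.degree_eq_sum_if_adj, h3.degree_eq]
      rfl
    -- A walk from the first vertex to the one at position `k` must leave the initial segment.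
    · obtain ⟨w⟩ := hG.preconnected (σ ⟨0, by omega⟩) (σ ⟨k, hk⟩)
      obtain ⟨d, -, hd1, hd2⟩ := w.exists_boundary_dart {v | (σ.symm v).val < k}
        (by simpa using hk0) (by simp)
      refine ⟨(σ.symm d.fst).val, hd1, (σ.symm d.snd).val, (σ.symm d.snd).2, by simpa using hd2, ?_⟩
      simp [hA, htσ, d.adj]
  have hx : Monotone (fun i => f (t i)) := fun i j hij => hσ (by
    rw [Fin.le_def]
    simp only
    omega)
  have key := hmat.gap_mul_le_energy hn hx (by rw [hsum f, hf0])
  rw [hsum (fun v => f v ^ 2)] at key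
  have hE : (∑ i, ∑ j, if G.Adj i j then (f i - f j) ^ 2 else 0) / 2 =
      ∑ i ∈ Finset.range (2 * n), ∑ j ∈ Finset.range (2 * n),
        if i < j then (A i j : ℝ) * (f (t j) - f (t i)) ^ 2 else 0 := by
    rw [← sum_sum_ite_lt_of_symm (2 * n) (fun i j => (A i j : ℝ) * (f (t j) - f (t i)) ^ 2)
      (fun i j => by rw [hmat.symm i j]; ring) (fun i => by simp),
      ← hsum (fun u => ∑ j, if G.Adj u j then (f u - f j) ^ 2 else 0)]
    congr 1
    refine Finset.sum_congr rfl fun i _ => ?_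
    rw [← hsum (fun v => if G.Adj (t i) v then (f (t i) - f v) ^ 2 else 0)]
    refine Finset.sum_congr rfl fun j _ => ?_
    simp only [hA]
    split_ifs
    · simp; ring
    · simp
  rw [← hE] at key
  exact le_of_mul_le_mul_right (key.trans hfE) hfpos

/-! ### Construction of the thickened path -/

/-- The bipartite graph on `2 * n` vertices whose bipartite adjacency matrix is given by a symmetric
relation `M` on `0, …, n - 1`: the vertices `2 * i` and `2 * j + 1` are adjacent iff `M i j`. -/
def bipartiteOfRel (n : ℕ) (M : ℕ → ℕ → Prop) (hM : ∀ i j, M i j → M j i) :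
    SimpleGraph (Fin (2 * n)) where
  Adj u v := u.val % 2 ≠ v.val % 2 ∧ M (u.val / 2) (v.val / 2)
  symm := ⟨fun _ _ h => ⟨h.1.symm, hM _ _ h.2⟩⟩
  loopless := ⟨fun _ h => h.1 rfl⟩

section bipartiteOfRel

variable {n : ℕ} {M : ℕ → ℕ → Prop} {hM : ∀ i j, M i j → M j i}

theorem bipartiteOfRel_isBipartite : (bipartiteOfRel n M hM).IsBipartite :=
  ⟨SimpleGraph.Coloring.mk (fun u => (⟨u.val % 2, by omega⟩ : Fin 2)) fun h he =>
    h.1 (congrArg Fin.val he)⟩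

/-- The entries (i, i+1) advance while switching sides, giving two zigzags; the entry (0, 0) joins
them. -/
theorem bipartiteOfRel_connected (hn : 0 < n) (h0 : M 0 0) (h1 : ∀ i, i + 1 < n → M i (i + 1)) :
    (bipartiteOfRel n M hM).Connected := by
  have key : ∀ i (hi : i < n),
      (bipartiteOfRel n M hM).Reachable ⟨0, by omega⟩ ⟨2 * i, by omega⟩ ∧
      (bipartiteOfRel n M hM).Reachable ⟨0, by omega⟩ ⟨2 * i + 1, by omega⟩ := fun i => by
    induction i with
    | zero =>
      refine fun hi => ⟨SimpleGraph.Reachable.refl _, SimpleGraph.Adj.reachable ⟨?_, ?_⟩⟩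
      · simp
      · simpa using h0
    | succ i ih =>
      intro hi
      obtain ⟨ha, hb⟩ := ih (by omega)
      have hm := h1 i hi
      refine ⟨hb.trans (SimpleGraph.Adj.reachable ⟨?_, ?_⟩),
        ha.trans (SimpleGraph.Adj.reachable ⟨?_, ?_⟩)⟩
      · simp only; omega
      · simp only
        rwa [show (2 * i + 1) / 2 = i by omega, show 2 * (i + 1) / 2 = i + 1 by omega]
      · simp only; omega
      · simp only
        rwa [show (2 * i) / 2 = i by omega, show (2 * (i + 1) + 1) / 2 = i + 1 by omega]
  have hr : ∀ v, (bipartiteOfRel n M hM).Reachable ⟨0, by omega⟩ v := fun v => by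
    have h := key (v.val / 2) (by omega)
    rcases Nat.mod_two_eq_zero_or_one v.val with h2 | h2
    · have e : (⟨2 * (v.val / 2), by omega⟩ : Fin (2 * n)) = v := Fin.ext (by simp only; omega)
      rw [← e]; exact h.1
    · have e : (⟨2 * (v.val / 2) + 1, by omega⟩ : Fin (2 * n)) = v := Fin.ext (by simp only; omega)
      rw [← e]; exact h.2
  have : Nonempty (Fin (2 * n)) := ⟨⟨0, by omega⟩⟩
  exact ⟨fun u v => (hr u).symm.trans (hr v)⟩

/-- Over each index `j` there is exactly one vertex on the side opposite to `u`. -/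
theorem bipartiteOfRel_sum [DecidableRel M] [DecidableRel (bipartiteOfRel n M hM).Adj]
    {R : Type*} [AddCommMonoid R] (F : Fin (2 * n) → R) (F' : ℕ → R)
    (hF : ∀ v : Fin (2 * n), F v = F' (v.val / 2)) (u : Fin (2 * n)) :
    ∑ v, (if (bipartiteOfRel n M hM).Adj u v then F v else 0) =
      ∑ j ∈ Finset.range n, if M (u.val / 2) j then F' j else 0 := by
  have h1 : ∀ v : Fin (2 * n), (if (bipartiteOfRel n M hM).Adj u v then F v else 0) =
      (fun v : ℕ => if u.val % 2 ≠ v % 2 ∧ M (u.val / 2) (v / 2) then F' (v / 2) else 0) v :=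
    fun v => by
      rw [hF]
      exact if_congr Iff.rfl rfl rfl
  rw [Finset.sum_congr rfl fun v _ => h1 v, ← Finset.sum_range
    (fun v : ℕ => if u.val % 2 ≠ v % 2 ∧ M (u.val / 2) (v / 2) then F' (v / 2) else 0),
    Finset.sum_range_two_mul]
  refine Finset.sum_congr rfl fun j _ => ?_
  rw [show 2 * j / 2 = j by omega, show (2 * j + 1) / 2 = j by omega,
    show 2 * j % 2 = 0 by omega, show (2 * j + 1) % 2 = 1 by omega]
  rcases Nat.mod_two_eq_zero_or_one u.val with h2 | h2 <;> simp [h2]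

theorem sum_fin_div_two (F : ℕ → ℝ) :
    ∑ v : Fin (2 * n), F (v.val / 2) = 2 * ∑ j ∈ Finset.range n, F j := by
  rw [← Finset.sum_range (fun v : ℕ => F (v / 2)), Finset.sum_range_two_mul, Finset.mul_sum]
  refine Finset.sum_congr rfl fun j _ => ?_
  rw [show 2 * j / 2 = j by omega, show (2 * j + 1) / 2 = j by omega]
  ring

theorem bipartiteOfRel_energy [DecidableRel M] [DecidableRel (bipartiteOfRel n M hM).Adj]
    (c : ℕ → ℝ) :
    (∑ i : Fin (2 * n), ∑ j : Fin (2 * n), if (bipartiteOfRel n M hM).Adj i j then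
        (c (i.val / 2) - c (j.val / 2)) ^ 2 else 0) / 2 =
      ∑ i ∈ Finset.range n, ∑ j ∈ Finset.range n, if M i j then (c i - c j) ^ 2 else 0 := by
  rw [Finset.sum_congr rfl fun u _ => bipartiteOfRel_sum
    (fun v : Fin (2 * n) => (c (u.val / 2) - c (v.val / 2)) ^ 2)
    (fun j => (c (u.val / 2) - c j) ^ 2) (fun _ => rfl) u,
    sum_fin_div_two (fun i => ∑ j ∈ Finset.range n, if M i j then (c i - c j) ^ 2 else 0)]
  ring

theorem bipartiteOfRel_degree [DecidableRel M] [DecidableRel (bipartiteOfRel n M hM).Adj]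
    (u : Fin (2 * n)) : (bipartiteOfRel n M hM).degree u =
      ((Finset.range n).filter fun j => M (u.val / 2) j).card := by
  have h := (bipartiteOfRel n M hM).degree_eq_sum_if_adj (R := ℕ) u
  rw [bipartiteOfRel_sum (fun _ => 1) (fun _ => 1) (fun _ => rfl) u] at h
  simpa using h

end bipartiteOfRel

theorem mem_cubicBipartiteConnectivities_of_rel {n : ℕ} (hn : 0 < n) (M : ℕ → ℕ → Prop)
    [DecidableRel M] (hM : ∀ i j, M i j → M j i) (h0 : M 0 0)
    (h1 : ∀ i, i + 1 < n → M i (i + 1))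
    (h3 : ∀ i < n, ((Finset.range n).filter fun j => M i j).card = 3)
    [DecidableRel (bipartiteOfRel n M hM).Adj] :
    algebraicConnectivity (bipartiteOfRel n M hM) ∈ cubicBipartiteConnectivities n := by
  refine ⟨bipartiteOfRel n M hM, bipartiteOfRel_connected hn h0 h1, fun u => ?_,
    bipartiteOfRel_isBipartite, ?_⟩
  · have h := bipartiteOfRel_degree (hM := hM) u
    rw [h3 _ (by omega)] at h
    convert h
  · congr!

/-- The band relation `|i - j| ≤ 1` on `0, …, n - 1`, modified near both ends so that every row
has three entries. -/
def cappedBand (n i j : ℕ) : Prop :=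
  (i ≤ j + 1 ∧ j ≤ i + 1 ∧ ¬(i = 2 ∧ j = 2) ∧ ¬(i + 3 = n ∧ j + 3 = n)) ∨
    (i = 0 ∧ j = 2) ∨ (i = 2 ∧ j = 0) ∨ (i + 1 = n ∧ j + 3 = n) ∨ (i + 3 = n ∧ j + 1 = n)

instance (n : ℕ) : DecidableRel (cappedBand n) := fun i j => by
  unfold cappedBand; infer_instance

theorem cappedBand_symm (n i j : ℕ) (h : cappedBand n i j) : cappedBand n j i := by
  unfold cappedBand at *; omega

theorem Finset.card_filter_range_eq_three {n : ℕ} {P : ℕ → Prop} [DecidablePred P] (a b c : ℕ)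
    (hab : a < b) (hbc : b < c) (h : ∀ j, j < n ∧ P j ↔ j = a ∨ j = b ∨ j = c) :
    ((Finset.range n).filter P).card = 3 := by
  rw [Finset.card_eq_three]
  refine ⟨a, b, c, hab.ne, (hab.trans hbc).ne, hbc.ne, ?_⟩
  ext j
  simp only [Finset.mem_filter, Finset.mem_range, Finset.mem_insert, Finset.mem_singleton]
  exact h j

/-- Row 0 of the band is one entry short: (2, 2) is traded for (0, 2) and (2, 0), and likewise at
the other end. The bound on `n` keeps rows 2 and n - 3 distinct. -/
theorem card_cappedBand {n : ℕ} (hn : 6 ≤ n) (i : ℕ) (hi : i < n) :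
    ((Finset.range n).filter fun j => cappedBand n i j).card = 3 := by
  by_cases h1 : i ≤ 1
  · exact Finset.card_filter_range_eq_three 0 1 2 (by omega) (by omega)
      fun j => by unfold cappedBand; omega
  by_cases h2 : i = 2
  · exact Finset.card_filter_range_eq_three 0 1 3 (by omega) (by omega)
      fun j => by unfold cappedBand; omega
  by_cases h3 : i + 3 < n
  · exact Finset.card_filter_range_eq_three (i - 1) i (i + 1) (by omega) (by omega)
      fun j => by unfold cappedBand; omega
  by_cases h4 : i + 3 = n
  · exact Finset.card_filter_range_eq_three (n - 4) (n - 2) (n - 1) (by omega) (by omega)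
      fun j => by unfold cappedBand; omega
  · exact Finset.card_filter_range_eq_three (n - 3) (n - 2) (n - 1) (by omega) (by omega)
      fun j => by unfold cappedBand; omega

open scoped Classical in
theorem cappedBand_mem {n : ℕ} (hn : 6 ≤ n) :
    algebraicConnectivity (bipartiteOfRel n (cappedBand n) (cappedBand_symm n)) ∈
      cubicBipartiteConnectivities n :=
  mem_cubicBipartiteConnectivities_of_rel (by omega) _ _ (by unfold cappedBand; omega)
    (fun i hi => by unfold cappedBand; omega) (card_cappedBand hn)

/-! ### Existence of the minimum -/

theorem cubicBipartiteConnectivities_nonempty {n : ℕ} (hn : 3 ≤ n) :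
    (cubicBipartiteConnectivities n).Nonempty := by
  classical
  rcases lt_or_ge n 6 with h | h
  -- K₃,₃ for n = 3; for n = 4, 5 a circulant relation omitting the differences ±2 modulo `n`, which
  -- leaves three per row.
  · let M : ℕ → ℕ → Prop := fun i j => 3 < n → i + 2 ≠ j ∧ j + 2 ≠ i ∧ i + 2 ≠ j + n ∧ j + 2 ≠ i + n
    refine ⟨_, mem_cubicBipartiteConnectivities_of_rel (n := n) (by omega) M
      (fun i j h => by simp only [M] at *; omega) (by simp only [M]; omega)
      (fun i hi => by simp only [M]; omega) ?_⟩
    simp only [M]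
    interval_cases n
    all_goals decide +revert
  · exact ⟨_, cappedBand_mem h⟩

theorem cubicBipartiteConnectivities_finite (n : ℕ) :
    (cubicBipartiteConnectivities n).Finite := by
  classical
  refine (Set.finite_range fun G : SimpleGraph (Fin (2 * n)) => algebraicConnectivity G).subset ?_
  rintro a ⟨G, -, -, -, rfl⟩
  exact ⟨G, by congr!⟩

theorem exists_isLeast_cubicBipartiteConnectivities {n : ℕ} (hn : 3 ≤ n) :
    ∃ a, IsLeast (cubicBipartiteConnectivities n) a :=
  ⟨_, (cubicBipartiteConnectivities_nonempty hn).csInf_mem (cubicBipartiteConnectivities_finite n),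
    fun _ ha => csInf_le (cubicBipartiteConnectivities_finite n).bddBelow ha⟩

/-! ### Trigonometric sums for the path eigenvector -/

theorem two_mul_sin_mul_sum_cos (θ φ : ℝ) (m : ℕ) :
    2 * Real.sin (θ / 2) * ∑ k ∈ Finset.range m, Real.cos (θ * k + φ) =
      Real.sin (θ * m - θ / 2 + φ) - Real.sin (φ - θ / 2) := by
  induction m with
  | zero => simp; ring_nf
  | succ m ih =>
    rw [Finset.sum_range_succ, mul_add, ih]
    have e1 : θ * m - θ / 2 + φ = (θ * m + φ) - θ / 2 := by ring
    have e2 : θ * (m + 1 : ℕ) - θ / 2 + φ = (θ * m + φ) + θ / 2 := by push_cast; ring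
    rw [e1, e2, Real.sin_sub (θ * m + φ), Real.sin_add (θ * m + φ)]
    ring

theorem sum_cos_two_pi_div_add {n : ℕ} (hn : 2 ≤ n) (φ : ℝ) :
    ∑ k ∈ Finset.range n, Real.cos (2 * Real.pi / n * k + φ) = 0 := by
  have hn0 : (0 : ℝ) < n := by positivity
  have h := two_mul_sin_mul_sum_cos (2 * Real.pi / n) φ n
  have e : 2 * Real.pi / n * n - 2 * Real.pi / n / 2 + φ =
      φ - 2 * Real.pi / n / 2 + 2 * Real.pi := by field_simp; ring
  rw [e, Real.sin_add_two_pi, sub_self] at h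
  have hs : 0 < Real.sin (2 * Real.pi / n / 2) := by
    refine Real.sin_pos_of_pos_of_lt_pi (by positivity) ?_
    have : (2 : ℝ) ≤ n := by exact_mod_cast hn
    rw [div_div, div_lt_iff₀ (by positivity)]
    nlinarith [Real.pi_pos]
  simpa [hs.ne'] using h

theorem sum_cos_half_integer {n : ℕ} (hn : 2 ≤ n) :
    ∑ k ∈ Finset.range n, Real.cos (Real.pi / n * k + Real.pi / n / 2) = 0 := by
  have hn0 : (0 : ℝ) < n := by positivity
  have h := two_mul_sin_mul_sum_cos (Real.pi / n) (Real.pi / n / 2) n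
  have e : Real.pi / n * n - Real.pi / n / 2 + Real.pi / n / 2 = Real.pi := by field_simp; ring
  rw [e, sub_self, Real.sin_pi, Real.sin_zero, sub_self] at h
  have hs : 0 < Real.sin (Real.pi / n / 2) := by
    refine Real.sin_pos_of_pos_of_lt_pi (by positivity) ?_
    have : (2 : ℝ) ≤ n := by exact_mod_cast hn
    rw [div_div, div_lt_iff₀ (by positivity)]
    nlinarith [Real.pi_pos]
  simpa [hs.ne'] using h

theorem sum_cos_sq_half_integer {n : ℕ} (hn : 2 ≤ n) :
    ∑ k ∈ Finset.range n, Real.cos (Real.pi / n * k + Real.pi / n / 2) ^ 2 = n / 2 := by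
  have h := sum_cos_two_pi_div_add hn (Real.pi / n)
  have e : ∀ k : ℕ, Real.cos (Real.pi / n * k + Real.pi / n / 2) ^ 2 =
      1 / 2 + Real.cos (2 * Real.pi / n * k + Real.pi / n) / 2 := fun k => by
    rw [Real.cos_sq]
    ring_nf
  simp only [e, Finset.sum_add_distrib, ← Finset.sum_div, h]
  simp [div_eq_mul_inv]

theorem sum_sq_cos_sub_le {n : ℕ} (hn : 2 ≤ n) :
    ∑ k ∈ Finset.range (n - 1), (Real.cos (Real.pi / n * (k + 1 : ℕ) + Real.pi / n / 2) -
      Real.cos (Real.pi / n * k + Real.pi / n / 2)) ^ 2 ≤ Real.pi ^ 2 / (2 * n) := by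
  have hn0 : (0 : ℝ) < n := by positivity
  have h := sum_cos_two_pi_div_add hn (2 * (Real.pi / n))
  have e : ∀ k : ℕ, (Real.cos (Real.pi / n * (k + 1 : ℕ) + Real.pi / n / 2) -
      Real.cos (Real.pi / n * k + Real.pi / n / 2)) ^ 2 =
      (4 * Real.sin (Real.pi / n / 2) ^ 2) *
        (1 / 2 - Real.cos (2 * Real.pi / n * k + 2 * (Real.pi / n)) / 2) := fun k => by
    have e1 : (Real.pi / n * (k + 1 : ℕ) + Real.pi / n / 2 +
      (Real.pi / n * k + Real.pi / n / 2)) / 2 = Real.pi / n * k + Real.pi / n := by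
      push_cast; ring
    have e2 : (Real.pi / n * (k + 1 : ℕ) + Real.pi / n / 2 -
      (Real.pi / n * k + Real.pi / n / 2)) / 2 = Real.pi / n / 2 := by
      push_cast; ring
    have e3 : 2 * Real.pi / n * k + 2 * (Real.pi / n) = 2 * (Real.pi / n * k + Real.pi / n) := by
      ring
    rw [Real.cos_sub_cos, e1, e2, e3, Real.cos_two_mul', Real.cos_sq']
    ring
  -- Adding the term k = n - 1 completes a full period, over which the cosines sum to zero.
  calc _ ≤ ∑ k ∈ Finset.range n, (Real.cos (Real.pi / n * (k + 1 : ℕ) + Real.pi / n / 2) -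
        Real.cos (Real.pi / n * k + Real.pi / n / 2)) ^ 2 :=
        Finset.sum_le_sum_of_subset_of_nonneg (Finset.range_mono (by omega))
          fun _ _ _ => sq_nonneg _
    _ = (4 * Real.sin (Real.pi / n / 2) ^ 2) * (n / 2) := by
        simp only [e, ← Finset.mul_sum, Finset.sum_sub_distrib, ← Finset.sum_div, h]
        simp [div_eq_mul_inv]
    _ ≤ (4 * (Real.pi / n / 2) ^ 2) * (n / 2) := by
        have : Real.sin (Real.pi / n / 2) ^ 2 ≤ (Real.pi / n / 2) ^ 2 := by
          rw [sq_le_sq, abs_of_nonneg (a := Real.pi / n / 2) (by positivity)]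
          exact (Real.abs_sin_le_abs).trans_eq (abs_of_nonneg (by positivity))
        gcongr
    _ = _ := by field_simp; ring

/-! ### Energy of the test function and the upper bound -/

/-- The energy on the capped band exceeds that of the path by four end terms. -/
theorem sum_cappedBand_le {n : ℕ} (q : ℕ → ℕ → ℝ) (hq0 : ∀ i j, 0 ≤ q i j)
    (hqs : ∀ i j, q i j = q j i) (hqd : ∀ i, q i i = 0) {K : ℝ} (hn : 6 ≤ n)
    (hK : ∀ i j, j ≤ i + 2 → i ≤ j + 2 → q i j ≤ K) :
    ∑ i ∈ Finset.range n, ∑ j ∈ Finset.range n, (if cappedBand n i j then q i j else 0) ≤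
      2 * ∑ k ∈ Finset.range (n - 1), q (k + 1) k + 4 * K := by
  have hterm : ∀ i ∈ Finset.range n, ∀ j ∈ Finset.range n,
      (if cappedBand n i j then q i j else 0) ≤
      (if j = i + 1 then q (i + 1) i else 0) + (if i = j + 1 then q (j + 1) j else 0) +
      (((if i = 0 then if j = 2 then K else 0 else 0) +
        (if i = 2 then if j = 0 then K else 0 else 0)) +
      ((if i = n - 1 then if j = n - 3 then K else 0 else 0) +
        (if i = n - 3 then if j = n - 1 then K else 0 else 0))) := fun i hi j hj => by
    have hi := Finset.mem_range.1 hi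
    have hj := Finset.mem_range.1 hj
    have hKn : 0 ≤ K := (hq0 0 0).trans (hK 0 0 (by omega) (by omega))
    have t : ∀ (p : Prop) [Decidable p] (a : ℝ), 0 ≤ a → 0 ≤ if p then a else 0 :=
      fun p _ a ha => by split_ifs; exacts [ha, le_rfl]
    have t1 := t (j = i + 1) _ (hq0 (i + 1) i)
    have t2 := t (i = j + 1) _ (hq0 (j + 1) j)
    have t3 := t (i = 0) _ (t (j = 2) K hKn)
    have t4 := t (i = 2) _ (t (j = 0) K hKn)
    have t5 := t (i = n - 1) _ (t (j = n - 3) K hKn)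
    have t6 := t (i = n - 3) _ (t (j = n - 1) K hKn)
    by_cases h : cappedBand n i j
    swap
    · rw [if_neg h]
      linarith
    rw [if_pos h]
    by_cases c1 : j = i + 1
    · rw [if_pos c1] at t1 ⊢
      have : q i j = q (i + 1) i := by rw [c1, hqs i]
      linarith
    by_cases c2 : i = j + 1
    · rw [if_pos c2] at t2 ⊢
      have : q i j = q (j + 1) j := by rw [c2]
      linarith
    by_cases c0 : i = j
    · rw [c0, hqd]; subst c0; linarith
    have hb : q i j ≤ K := by
      refine hK i j ?_ ?_ <;> (unfold cappedBand at h; omega)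
    have hor : (i = 0 ∧ j = 2) ∨ (i = 2 ∧ j = 0) ∨ (i = n - 1 ∧ j = n - 3) ∨
        (i = n - 3 ∧ j = n - 1) := by unfold cappedBand at h; omega
    rcases hor with ⟨a, b⟩ | ⟨a, b⟩ | ⟨a, b⟩ | ⟨a, b⟩
    · have : (if i = 0 then if j = 2 then K else 0 else 0) = K := by rw [if_pos a, if_pos b]
      linarith
    · have : (if i = 2 then if j = 0 then K else 0 else 0) = K := by rw [if_pos a, if_pos b]
      linarith
    · have : (if i = n - 1 then if j = n - 3 then K else 0 else 0) = K := by
        rw [if_pos a, if_pos b]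
      linarith
    · have : (if i = n - 3 then if j = n - 1 then K else 0 else 0) = K := by
        rw [if_pos a, if_pos b]
      linarith
  refine (Finset.sum_le_sum fun i hi => Finset.sum_le_sum fun j hj => hterm i hi j hj).trans ?_
  have hpt : ∀ a b, a < n → b < n → ∑ i ∈ Finset.range n, ∑ j ∈ Finset.range n,
      (if i = a then if j = b then K else 0 else 0) = K := fun a b ha hb => by
    simp [Finset.sum_ite_irrel, ha, hb]
  have hband : ∑ i ∈ Finset.range n, ∑ j ∈ Finset.range n,
      (if j = i + 1 then q (i + 1) i else 0) = ∑ k ∈ Finset.range (n - 1), q (k + 1) k := by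
    rw [← Finset.sum_range_ite_lt (show n - 1 ≤ n by omega)]
    refine Finset.sum_congr rfl fun i _ => ?_
    rw [Finset.sum_ite_eq' _ (i + 1)]
    simp only [Finset.mem_range]
    congr 1
    simp only [eq_iff_iff]
    omega
  have hband' : ∑ i ∈ Finset.range n, ∑ j ∈ Finset.range n,
      (if i = j + 1 then q (j + 1) j else 0) = ∑ k ∈ Finset.range (n - 1), q (k + 1) k := by
    rw [Finset.sum_comm, hband]
  simp only [Finset.sum_add_distrib]
  rw [hpt 0 2 (by omega) (by omega), hpt 2 0 (by omega) (by omega),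
    hpt (n - 1) (n - 3) (by omega) (by omega), hpt (n - 3) (n - 1) (by omega) (by omega),
    hband, hband']
  linarith

open scoped Classical in
theorem algebraicConnectivity_cappedBand_le {n : ℕ} (hn : 6 ≤ n) :
    algebraicConnectivity (bipartiteOfRel n (cappedBand n) (cappedBand_symm n)) ≤
      Real.pi ^ 2 / n ^ 2 * (1 + 16 / n) := by
  have hn0 : (0 : ℝ) < n := by positivity
  set c : ℕ → ℝ := fun k => Real.cos (Real.pi / n * k + Real.pi / n / 2) with hc
  have h := algebraicConnectivity_mul_le (bipartiteOfRel n (cappedBand n) (cappedBand_symm n))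
    (by simp; omega) (fun v => c (v.val / 2))
    (by rw [sum_fin_div_two c, sum_cos_half_integer (by omega), mul_zero])
  rw [sum_fin_div_two (fun k => c k ^ 2), sum_cos_sq_half_integer (by omega)] at h
  rw [bipartiteOfRel_energy c] at h
  -- Cosine is 1-Lipschitz, so each of the four cap entries costs at most (2π/n)².
  have hlip : ∀ i j : ℕ, j ≤ i + 2 → i ≤ j + 2 → (c i - c j) ^ 2 ≤ (2 * Real.pi / n) ^ 2 :=
    fun i j h1 h2 => by
      have h1' : (j : ℝ) ≤ i + 2 := by exact_mod_cast h1
      have h2' : (i : ℝ) ≤ j + 2 := by exact_mod_cast h2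
      have hl := Real.abs_cos_sub_cos_le (Real.pi / n * i + Real.pi / n / 2)
        (Real.pi / n * j + Real.pi / n / 2)
      rw [sq_le_sq, abs_of_nonneg (a := 2 * Real.pi / n) (by positivity)]
      refine hl.trans ?_
      rw [show Real.pi / n * i + Real.pi / n / 2 - (Real.pi / n * j + Real.pi / n / 2) =
        Real.pi / n * (i - j) by ring, abs_mul, abs_of_nonneg (a := Real.pi / n) (by positivity),
        show 2 * Real.pi / n = Real.pi / n * 2 by ring]
      refine mul_le_mul_of_nonneg_left (abs_le.2 ⟨by linarith, by linarith⟩) (by positivity)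
  have hB := sum_cappedBand_le (n := n) (fun i j => (c i - c j) ^ 2) (fun _ _ => sq_nonneg _)
    (fun i j => by ring) (fun i => by ring) hn hlip
  have hD := sum_sq_cos_sub_le (n := n) (by omega)
  have hfin := (h.trans hB).trans (add_le_add_left (mul_le_mul_of_nonneg_left hD (by norm_num)) _)
  -- The caps cost 16π²/n² against the main term π²/n, hence the factor 1 + 16/n; the squared norm
  -- is `n`.
  have e : 2 * (Real.pi ^ 2 / (2 * n)) + 4 * (2 * Real.pi / n) ^ 2 =
      Real.pi ^ 2 / n ^ 2 * (1 + 16 / n) * (2 * ((n : ℝ) / 2)) := by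
    field_simp
    ring
  rw [e] at hfin
  exact le_of_mul_le_mul_right hfin (by positivity)

/-! ### Asymptotics -/

/-- The right side is 4sin²t with t = π/(2n). From sin t ≥ t - t³/6 the relative loss is at most
t²/3, and t² ≤ 2/n. -/
theorem le_two_sub_two_mul_cos {n : ℕ} (hn : 3 ≤ n) :
    (1 - 2 / n) * (Real.pi ^ 2 / n ^ 2) ≤ 2 - 2 * Real.cos (Real.pi / n) := by
  have hn3 : (3 : ℝ) ≤ n := by exact_mod_cast hn
  have hn0 : (0 : ℝ) < n := by linarith
  set t := Real.pi / n / 2 with ht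
  have ht0 : 0 < t := by positivity
  have htn : t * n = Real.pi / 2 := by rw [ht]; field_simp
  have ht1 : t ≤ 1 := by
    rw [ht, div_div, div_le_one (by positivity)]
    linarith [Real.pi_le_four]
  have hs := Real.sin_gt_sub_cube ht0
  have hcos : 2 - 2 * Real.cos (Real.pi / n) = 4 * Real.sin t ^ 2 := by
    have : Real.pi / n = 2 * t := by rw [ht]; ring
    rw [this, Real.cos_two_mul, Real.cos_sq']
    ring
  have e : Real.pi ^ 2 / n ^ 2 = 4 * t ^ 2 := by rw [ht]; field_simp; ring
  rw [hcos, e]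
  have h1 : 0 ≤ t - t ^ 3 / 6 := by nlinarith [pow_pos ht0 2]
  have h2 : (t - t ^ 3 / 6) ^ 2 ≤ Real.sin t ^ 2 := pow_le_pow_left₀ h1 hs.le 2
  have h3 : t ^ 2 ≤ 2 / n := by
    rw [le_div_iff₀ hn0]
    nlinarith [Real.pi_le_four]
  nlinarith [pow_pos ht0 2, pow_pos ht0 4, pow_pos ht0 6]

theorem theorem1p2 :
    ∃ ε : ℕ → ℝ, Tendsto ε atTop (𝓝 0) ∧
      ∀ n : ℕ, 3 ≤ n →
        IsLeast (cubicBipartiteConnectivities n) ((1 + ε n) * (Real.pi ^ 2 / (n : ℝ) ^ 2)) := by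
  classical
  choose! a ha using fun n (hn : 3 ≤ n) => exists_isLeast_cubicBipartiteConnectivities hn
  have hmul : ∀ n : ℕ, 3 ≤ n →
      (1 + (a n / (Real.pi ^ 2 / (n : ℝ) ^ 2) - 1)) * (Real.pi ^ 2 / (n : ℝ) ^ 2) = a n :=
    fun n hn => by
      have : (0 : ℝ) < n := by exact_mod_cast (by omega : 0 < n)
      field_simp
      ring
  -- The minimum determines ε, which is squeezed between -2/n and 16/n.
  refine ⟨fun n => a n / (Real.pi ^ 2 / (n : ℝ) ^ 2) - 1, ?_, fun n hn => ?_⟩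
  · have hlim : ∀ C : ℝ, Tendsto (fun n : ℕ => C / n) atTop (𝓝 0) := fun C =>
      tendsto_const_div_atTop_nhds_zero_nat C
    refine tendsto_of_tendsto_of_tendsto_of_le_of_le' (hlim (-2)) (hlim 16) ?_ ?_
    · filter_upwards [eventually_ge_atTop 3] with n hn
      obtain ⟨G, hG, h3, hb, hGa⟩ := (ha n hn).1
      have h := (le_two_sub_two_mul_cos hn).trans (hG.gap_le_algebraicConnectivity (by omega) h3 hb)
      rw [hGa, ← le_div_iff₀ (by have : (0 : ℝ) < n := by exact_mod_cast (by omega : 0 < n)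
                                 positivity)] at h
      linarith [neg_div (n : ℝ) 2]
    · filter_upwards [eventually_ge_atTop 6] with n hn
      have h := ((ha n (by omega)).2 (cappedBand_mem hn)).trans
        (algebraicConnectivity_cappedBand_le hn)
      rw [mul_comm, ← div_le_iff₀ (by have : (0 : ℝ) < n := by exact_mod_cast (by omega : 0 < n)
                                      positivity)] at h
      linarith
  · simp only [hmul n hn]
    exact ha n hn
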